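/- A pseudocomplemented distributive lattice is an algebra $(L,\vee,\wedge,0,1,{}^*)$ such that $(L,\vee,\wedge,0,1)$ is a bounded distributive lattice and, for all $x,y\in L$, $x\le y^*$ if and only if $x\wedge y=0$; homomorphisms of these algebras are called $*$-homomorphisms. For $n\in\mathbb N$ let $B_n^+={\bf 2}^n\oplus{\bf 1}$ be the Boolean lattice ${\bf 2}^n$ with a new top element added, regarded as a pseudocomplemented distributive lattice, and let $\mathcal B_n$ be the variety of pseudocomplemented distributive lattices generated by $B_n^+$. An algebra $A\in\mathcal B_n$ is in the amalgamation class $\operatorname{Amal}(\mathcal B_n)$ if for all $B_0,B_1\in\mathcal B_n$ and all one-to-one $*$-homomorphisms $\alpha_0:A\to B_0$, $\alpha_1:A\to B_1$ there exist $C\in\mathcal B_n$ and one-to-one $*$-homomorphisms $\beta_0:B_0\to C$, $\beta_1:B_1\to C$ such that $\beta_0\circ\alpha_0=\beta_1\circ\alpha_1$. **Proposition.** Let $n\ge 2$ and let $A$ be in $\operatorname{Amal}(\mathcal B_n)$. Then for every $B$ in $\mathcal B_n$ containing $A$ as a subalgebra, every $*$-homomorphism from $A$ to $B_n^+$ can be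 extended to a $*$-homomorphism from $B$ to $B_n^+$. -/

import Mathlib

universe u v

/-- A pseudocomplemented distributive lattice `(L, ⊔, ⊓, ⊥, ⊤, ᶜ)`: a bounded distributive lattice
with a unary operation `ᶜ` such that `x ≤ yᶜ` if and only if `x ⊓ y = ⊥`. -/
class PDLattice (L : Type u) extends DistribLattice L, BoundedOrder L, Compl L where
  le_compl_iff : ∀ x y : L, x ≤ yᶜ ↔ x ⊓ y = ⊥

/-- The `*`-homomorphisms: maps preserving `⊔`, `⊓`, `⊥`, `⊤` and the pseudocomplement. -/
structure PDHom (A : Type u) (B : Type v) [PDLattice A] [PDLattice B] extends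
    BoundedLatticeHom A B where
  map_compl' : ∀ a : A, toFun aᶜ = (toFun a)ᶜ

instance PDHom.instFunLike {A : Type u} {B : Type v} [PDLattice A] [PDLattice B] :
    FunLike (PDHom A B) A B where
  coe f := f.toFun
  coe_injective := by
    rintro ⟨⟨⟨⟨f, _⟩, _⟩, _, _⟩, _⟩ ⟨⟨⟨⟨g, _⟩, _⟩, _, _⟩, _⟩ h
    cases h
    rfl

/-- Terms in the language `(⊔, ⊓, ⊥, ⊤, ᶜ)` with variables indexed by `ℕ`. -/
inductive PDTerm : Type
  | var : ℕ → PDTerm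
  | bot : PDTerm
  | top : PDTerm
  | sup : PDTerm → PDTerm → PDTerm
  | inf : PDTerm → PDTerm → PDTerm
  | compl : PDTerm → PDTerm

/-- The value of a term in `L` under an assignment `ρ` of the variables. -/
def PDTerm.eval {L : Type u} [PDLattice L] (ρ : ℕ → L) : PDTerm → L
  | .var i => ρ i
  | .bot => ⊥
  | .top => ⊤
  | .sup s t => s.eval ρ ⊔ t.eval ρ
  | .inf s t => s.eval ρ ⊓ t.eval ρ
  | .compl s => (s.eval ρ)ᶜ

/-- The identity `s ≈ t` holds in `L`. -/
def SatisfiesIdentity (L : Type u) [PDLattice L] (s t : PDTerm) : Prop :=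
  ∀ ρ : ℕ → L, s.eval ρ = t.eval ρ

/-- `L` belongs to the variety (equational class) generated by `K`:
every identity which holds in `K` holds in `L`. -/
def InVarietyGeneratedBy (K : Type v) [PDLattice K] (L : Type u) [PDLattice L] : Prop :=
  ∀ s t : PDTerm, SatisfiesIdentity K s t → SatisfiesIdentity L s t

/-- The underlying lattice of `2ⁿ ⊕ 1`: the Boolean lattice `2ⁿ` with a new top element. -/
abbrev BPlus (n : ℕ) : Type := WithTop (Fin n → Bool)

/-- Pseudocomplementation on `2ⁿ ⊕ 1`: the new top goes to `⊥`, the bottom goes to the new top,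
and any other element goes to its Boolean complement in `2ⁿ`. -/
noncomputable def BPlus.compl {n : ℕ} : BPlus n → BPlus n
  | none => ⊥
  | some a => if a = ⊥ then ⊤ else ((aᶜ : Fin n → Bool) : WithTop (Fin n → Bool))

/-- The pseudocomplemented distributive lattice `2ⁿ ⊕ 1`. -/
noncomputable instance BPlus.instPDLattice (n : ℕ) : PDLattice (BPlus n) where
  toDistribLattice := inferInstance
  toBoundedOrder := inferInstance
  compl := BPlus.compl
  le_compl_iff := by
    intro x y
    change x ≤ BPlus.compl y ↔ x ⊓ y = ⊥
    induction y using WithTop.recTopCoe with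
    | top =>
      change x ≤ ⊥ ↔ _
      simp
    | coe a =>
      change x ≤ (if a = ⊥ then ⊤ else ((aᶜ : Fin n → Bool) : WithTop (Fin n → Bool))) ↔ _
      split_ifs with h
      · subst h
        simp
      · induction x using WithTop.recTopCoe with
        | top => simp [h]
        | coe b =>
          rw [WithTop.coe_le_coe, le_compl_iff_disjoint_right, disjoint_iff, ← WithTop.coe_inf,
            ← WithTop.coe_bot, WithTop.coe_inj]

/-- The class `𝓑ₙ`: the variety of pseudocomplemented distributive lattices generated by
`2ⁿ ⊕ 1`. -/
def VarietyB (n : ℕ) (L : Type u) [PDLattice L] : Prop :=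
  InVarietyGeneratedBy (BPlus n) L

/-- `A` is in the amalgamation class `Amal(V)` of a class `V` of pseudocomplemented
distributive lattices: `A` is in `V`, and any two embeddings of `A` into members of `V` can be
completed to a commutative square of embeddings into a member of `V`. -/
def IsAmalgamationBase (V : ∀ (L : Type u) [PDLattice L], Prop) (A : Type u) [PDLattice A] :
    Prop :=
  V A ∧
    ∀ (B₀ B₁ : Type u) [PDLattice B₀] [PDLattice B₁], V B₀ → V B₁ →
      ∀ (α₀ : PDHom A B₀) (α₁ : PDHom A B₁),
        Function.Injective α₀ → Function.Injective α₁ →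
          ∃ (C : Type u) (_ : PDLattice C), V C ∧
            ∃ (β₀ : PDHom B₀ C) (β₁ : PDHom B₁ C),
              Function.Injective β₀ ∧ Function.Injective β₁ ∧
                ∀ a : A, β₀ (α₀ a) = β₁ (α₁ a)

/-!
The extension is obtained by amalgamating `B` with `A × Bₙ⁺` over `A`, where `A` is embedded in the
product by `a ↦ (a, f a)`. If `C ∈ 𝓑ₙ` is the amalgam, it is enough to extend the second projection
`A × Bₙ⁺ → Bₙ⁺` to a homomorphism `C → Bₙ⁺` (`exists_extend_snd`): composing this extension with
`B → C` gives the required map.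

Homomorphisms to `Bₙ⁺` are built from prime ideals. The prime filters of `Bₙ⁺` are `{⊤}` and the `n`
principal filters of the atoms, all of which contain `{⊤}`. Accordingly, a homomorphism `C → Bₙ⁺`
is given by a prime ideal `P` of `C` together with a list `M₁, …, Mₙ` of all the minimal prime
ideals contained in `P` (`BPlus.homOfPrime`). Here `P` is a prime ideal which meets `A × Bₙ⁺` in
`A × 2ⁿ`; it exists because `⊤` is join-irreducible in `Bₙ⁺`. Inside `P` there is, for each atom
`i`, a minimal prime ideal `Mᵢ` not containing the image of `(⊥, i)`
(`exists_isMinimalPrimeIdeal_le`). These are distinct, and they are all the minimal prime ideals in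
`P`: for `n ≥ 1`, an identity of `Bₙ⁺` expressing that `n + 1` pairwise disjoint elements cannot all
be nonzero bounds the number of minimal prime ideals below a prime ideal by `n`
(`VarietyB.exists_eq_of_isMinimalPrimeIdeal`).
-/

open Order

/-! ### Pseudocomplements -/

namespace PDLattice

variable {L : Type u} [PDLattice L]

protected theorem inf_compl_self (x : L) : x ⊓ xᶜ = ⊥ := by
  rw [inf_comm]; exact (le_compl_iff _ _).1 le_rfl

theorem le_compl_compl (x : L) : x ≤ xᶜᶜ := (le_compl_iff _ _).2 (PDLattice.inf_compl_self x)

theorem compl_anti {x y : L} (h : x ≤ y) : yᶜ ≤ xᶜ := by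
  rw [le_compl_iff, eq_bot_iff, ← PDLattice.inf_compl_self y, inf_comm y]
  exact inf_le_inf_left _ h

protected theorem compl_bot : (⊥ : L)ᶜ = ⊤ := top_le_iff.1 ((le_compl_iff _ _).2 (by simp))

protected theorem compl_top : (⊤ : L)ᶜ = ⊥ := by simpa using PDLattice.inf_compl_self (⊤ : L)

protected theorem compl_eq_top {x : L} : xᶜ = ⊤ ↔ x = ⊥ := by
  rw [← top_le_iff, le_compl_iff, top_inf_eq]

theorem compl_sup_self_compl (x : L) : (x ⊔ xᶜ)ᶜ = ⊥ := by
  rw [eq_bot_iff, ← PDLattice.inf_compl_self (xᶜ)]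
  exact le_inf (compl_anti le_sup_left) (compl_anti le_sup_right)

theorem eq_bot_of_le_compl {x y : L} (h : x ≤ y) (h' : x ≤ yᶜ) : x = ⊥ := by
  rw [eq_bot_iff, ← PDLattice.inf_compl_self y]; exact le_inf h h'

theorem compl_inf_le {c x : L} : (c ⊓ xᶜ)ᶜ ⊓ c ≤ xᶜᶜ := by
  rw [le_compl_iff, inf_assoc, inf_comm, PDLattice.inf_compl_self]

theorem compl_compl_inf_le (x y : L) : xᶜᶜ ⊓ yᶜᶜ ≤ (x ⊓ y)ᶜᶜ := by
  rw [le_compl_iff]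
  have h : xᶜᶜ ⊓ yᶜᶜ ⊓ (x ⊓ y)ᶜ ⊓ x ≤ yᶜ := by
    rw [le_compl_iff, eq_bot_iff, ← PDLattice.inf_compl_self (x ⊓ y), inf_comm (x ⊓ y)]
    exact le_inf (inf_le_left.trans (inf_le_left.trans inf_le_right))
      (inf_le_inf_right _ inf_le_right)
  have h' := eq_bot_of_le_compl h
    (inf_le_left.trans (inf_le_left.trans inf_le_right))
  exact eq_bot_of_le_compl ((le_compl_iff _ _).2 h')
    (inf_le_left.trans inf_le_left)

end PDLattice

open PDLattice

/-! ### Minimal prime ideals -/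

/-- A minimal prime ideal, described as a prime ideal which contains exactly one of `x` and `xᶜ` for
every `x`. The complements of these ideals are the maximal proper filters. -/
structure IsMinimalPrimeIdeal {L : Type u} [PDLattice L] (J : Order.Ideal L) : Prop where
  isPrime : J.IsPrime
  compl_notMem : ∀ x ∈ J, xᶜ ∉ J

section MinimalPrime

variable {L : Type u} [PDLattice L]

theorem Order.Ideal.IsPrime.top_notMem' {J : Order.Ideal L} (hJ : J.IsPrime) : (⊤ : L) ∉ J :=
  hJ.toIsProper.top_notMem

theorem Order.Ideal.IsPrime.inf_mem_iff {J : Order.Ideal L} (hJ : J.IsPrime) {x y : L} :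
    x ⊓ y ∈ J ↔ x ∈ J ∨ y ∈ J :=
  ⟨hJ.mem_or_mem, fun h => h.elim (J.lower inf_le_left) (J.lower inf_le_right)⟩

theorem Order.Ideal.IsPrime.finsetInf_mem_iff {J : Order.Ideal L} (hJ : J.IsPrime) {α : Type*}
    (s : Finset α) (x : α → L) : s.inf x ∈ J ↔ ∃ i ∈ s, x i ∈ J := by
  classical
  induction s using Finset.induction_on with
  | empty => simpa using hJ.top_notMem'
  | insert a s _ ih => simp [Finset.inf_insert, hJ.inf_mem_iff, ih]

theorem IsMinimalPrimeIdeal.compl_mem_iff {J : Order.Ideal L} (hJ : IsMinimalPrimeIdeal J) {x : L} :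
    xᶜ ∈ J ↔ x ∉ J := by
  refine ⟨fun h h' => hJ.compl_notMem x h' h, fun h => ?_⟩
  have := hJ.isPrime.mem_or_mem (x := x) (y := xᶜ)
    (by rw [PDLattice.inf_compl_self]; exact J.bot_mem)
  exact this.resolve_left h

theorem IsMinimalPrimeIdeal.eq_of_le {J K : Order.Ideal L} (hJ : IsMinimalPrimeIdeal J)
    (hK : IsMinimalPrimeIdeal K) (h : J ≤ K) : J = K := by
  refine le_antisymm h fun x hx => ?_
  by_contra hxJ
  exact hK.compl_notMem x hx (h (hJ.compl_mem_iff.2 hxJ))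

/-- If `cᶜ` lies in the prime ideal `P`, then `P` contains a minimal prime ideal avoiding `c`. -/
theorem exists_isMinimalPrimeIdeal_le {P : Order.Ideal L} (hP : P.IsPrime) {c : L} (hc : cᶜ ∈ P) :
    ∃ J : Order.Ideal L, IsMinimalPrimeIdeal J ∧ J ≤ P ∧ c ∉ J := by
  -- `F` is the filter generated by `c`, the complement of `P`, and the dense elements.
  -- A prime ideal which is disjoint from all dense elements `x ⊔ xᶜ` is minimal.
  have hF : IsPFilter {x : L | (c ⊓ xᶜ)ᶜ ∉ P} := by
    refine IsPFilter.of_def ⟨⊤, ?_⟩ ?_ ?_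
    · simpa [PDLattice.compl_top, PDLattice.compl_bot] using hP.top_notMem'
    · intro x hx y hy
      refine ⟨x ⊓ y, fun h => ?_, inf_le_left, inf_le_right⟩
      have key : (c ⊓ xᶜ)ᶜ ⊓ (c ⊓ yᶜ)ᶜ ≤ (c ⊓ (x ⊓ y)ᶜ)ᶜ := by
        rw [le_compl_iff, ← inf_assoc]
        refine eq_bot_of_le_compl inf_le_right (inf_le_left.trans
          (le_trans (le_inf ?_ ?_) (compl_compl_inf_le x y)))
        · exact (inf_le_inf_right _ inf_le_left).trans compl_inf_le
        · exact (inf_le_inf_right _ inf_le_right).trans compl_inf_le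
      exact (hP.mem_or_mem (P.lower key h)).elim hx hy
    · intro x y hxy hx hy
      exact hx (P.lower (compl_anti (inf_le_inf_left _ (compl_anti hxy))) hy)
  obtain ⟨J, hJ, -, hd⟩ := DistribLattice.prime_ideal_of_disjoint_filter_ideal
    (F := hF.toPFilter) (I := (⊥ : Order.Ideal L)) (by
      rw [Set.disjoint_left]
      rintro x hx hx'
      obtain rfl : x = ⊥ := le_bot_iff.1 hx'
      exact hx (by simpa [PDLattice.compl_bot] using hc))
  have hd' : ∀ x ∈ J, (c ⊓ xᶜ)ᶜ ∈ P := by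
    intro x hx
    by_contra h
    exact Set.disjoint_left.1 hd h hx
  refine ⟨J, ⟨hJ, fun x hx hx' => ?_⟩, fun x hx => ?_, fun h => ?_⟩
  · have := hd' _ (J.sup_mem hx hx')
    rw [compl_sup_self_compl, inf_bot_eq, PDLattice.compl_bot] at this
    exact hP.top_notMem' this
  · exact P.lower ((le_compl_compl x).trans (compl_anti inf_le_right)) (hd' x hx)
  · have := hd' c h
    rw [PDLattice.inf_compl_self, PDLattice.compl_bot] at this
    exact hP.top_notMem' this

end MinimalPrime

/-! ### An identity bounding the number of minimal prime ideals -/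

/-- The join of the terms `t 0, …, t (k - 1)`. -/
def PDTerm.bigSup (t : ℕ → PDTerm) : ℕ → PDTerm
  | 0 => .bot
  | k + 1 => .sup (t k) (bigSup t k)

/-- The meet of the terms `t 0, …, t (k - 1)`. -/
def PDTerm.bigInf (t : ℕ → PDTerm) : ℕ → PDTerm
  | 0 => .top
  | k + 1 => .inf (t k) (bigInf t k)

theorem PDTerm.eval_bigSup {L : Type u} [PDLattice L] (ρ : ℕ → L) (t : ℕ → PDTerm) (k : ℕ) :
    (bigSup t k).eval ρ = (Finset.range k).sup fun i => (t i).eval ρ := by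
  induction k with
  | zero => rfl
  | succ k ih => rw [Finset.range_add_one, Finset.sup_insert, ← ih]; rfl

theorem PDTerm.eval_bigInf {L : Type u} [PDLattice L] (ρ : ℕ → L) (t : ℕ → PDTerm) (k : ℕ) :
    (bigInf t k).eval ρ = (Finset.range k).inf fun i => (t i).eval ρ := by
  induction k with
  | zero => rfl
  | succ k ih => rw [Finset.range_add_one, Finset.inf_insert, ← ih]; rfl

/-- The meet of `x i` and all `(x j)ᶜ` with `j ≠ i`, `j < m`. For fixed `x` and varying `i < m`
these elements are pairwise disjoint, which allows disjointness to be built into an identity. -/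
def separated {L : Type u} [PDLattice L] (x : ℕ → L) (m i : ℕ) : L :=
  (Finset.range m).inf fun j => if j = i then x j else (x j)ᶜ

theorem separated_inf_separated {L : Type u} [PDLattice L] (x : ℕ → L) {m i j : ℕ}
    (hi : i < m) (hij : i ≠ j) : separated x m i ⊓ separated x m j = ⊥ := by
  refine eq_bot_of_le_compl (y := x i) (inf_le_left.trans ?_) (inf_le_right.trans ?_)
  · exact (Finset.inf_le (Finset.mem_range.2 hi)).trans (by simp)
  · exact (Finset.inf_le (Finset.mem_range.2 hi)).trans (by simp [hij])

/-- The term whose value at `x` is the join of the pseudocomplements of the `n + 1` elements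
`separated x (n + 1) i`. -/
def PDTerm.supComplSeparated (n : ℕ) : PDTerm :=
  bigSup (fun i => .compl (bigInf (fun j => if j = i then .var j else .compl (.var j)) (n + 1)))
    (n + 1)

theorem PDTerm.eval_supComplSeparated {L : Type u} [PDLattice L] (x : ℕ → L) (n : ℕ) :
    (supComplSeparated n).eval x =
      (Finset.range (n + 1)).sup fun i => (separated x (n + 1) i)ᶜ := by
  simp only [supComplSeparated, eval_bigSup, eval, eval_bigInf, separated]
  congr! with i j
  split_ifs <;> rfl

/-- The atoms of `2ⁿ ⊕ 1`. -/
def BPlus.atom {n : ℕ} (i : Fin n) : BPlus n := ((fun j => decide (j = i) : Fin n → Bool) : BPlus n)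

theorem BPlus.atom_le_coe {n : ℕ} {i : Fin n} {s : Fin n → Bool} :
    atom i ≤ (s : BPlus n) ↔ s i = true := by
  rw [atom, WithTop.coe_le_coe, Pi.le_def]
  refine ⟨fun h => by simpa [Bool.le_iff_imp] using h i, fun h j => ?_⟩
  by_cases hj : j = i
  · subst hj; simp [h]
  · simp [hj]

theorem BPlus.atom_ne_bot {n : ℕ} (i : Fin n) : atom i ≠ (⊥ : BPlus n) := by
  intro h
  exact Bool.false_ne_true (atom_le_coe.1 (h.le : _ ≤ ((⊥ : Fin n → Bool) : BPlus n)))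

theorem BPlus.exists_atom_le {n : ℕ} (hn : 1 ≤ n) {x : BPlus n} (hx : x ≠ ⊥) :
    ∃ i : Fin n, atom i ≤ x := by
  induction x using WithTop.recTopCoe with
  | top => exact ⟨⟨0, hn⟩, le_top⟩
  | coe s =>
    by_contra! h
    refine hx ?_
    rw [← WithTop.coe_bot, WithTop.coe_inj]
    funext i
    simpa [atom_le_coe] using h i

theorem BPlus.sup_compl_separated {n : ℕ} (hn : 1 ≤ n) (x : ℕ → BPlus n) :
    ((Finset.range (n + 1)).sup fun i => (separated x (n + 1) i)ᶜ) = ⊤ := by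
  suffices h : ∃ i ∈ Finset.range (n + 1), separated x (n + 1) i = ⊥ by
    obtain ⟨i, hi, h⟩ := h
    rw [← top_le_iff, ← PDLattice.compl_eq_top.2 h]
    exact Finset.le_sup (f := fun i => (separated x (n + 1) i)ᶜ) hi
  by_contra! h
  choose k hk using fun i : Fin (n + 1) => exists_atom_le hn (h i (Finset.mem_range.2 i.2))
  -- Two of the `n + 1` elements lie above the same atom, although they are disjoint.
  obtain ⟨i, j, hij, hkij⟩ := Fintype.exists_ne_map_eq_of_card_lt k (by simp)
  refine atom_ne_bot (k i) (eq_bot_iff.2 ?_)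
  rw [← separated_inf_separated x i.2 (Fin.val_injective.ne hij)]
  exact le_inf (hk i) (hkij ▸ hk j)

theorem VarietyB.sup_compl_separated {n : ℕ} (hn : 1 ≤ n) {L : Type u} [PDLattice L]
    (hL : VarietyB n L) (x : ℕ → L) :
    ((Finset.range (n + 1)).sup fun i => (separated x (n + 1) i)ᶜ) = ⊤ := by
  rw [← PDTerm.eval_supComplSeparated]
  exact hL (.supComplSeparated n) .top (fun ρ =>
    (PDTerm.eval_supComplSeparated ρ n).trans (BPlus.sup_compl_separated hn ρ)) x

/-- In a member of `𝓑ₙ`, a prime ideal contains at most `n` minimal prime ideals. -/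
theorem VarietyB.exists_eq_of_isMinimalPrimeIdeal {n : ℕ} (hn : 1 ≤ n) {L : Type u} [PDLattice L]
    (hL : VarietyB n L) {P : Order.Ideal L} (hP : P.IsPrime) (J : ℕ → Order.Ideal L)
    (hJ : ∀ i, IsMinimalPrimeIdeal (J i)) (hJP : ∀ i, J i ≤ P) :
    ∃ i < n + 1, ∃ j < n + 1, i ≠ j ∧ J i = J j := by
  by_contra! h
  have hu : ∀ i j, ∃ u : L, i < n + 1 → j < n + 1 → i ≠ j → u ∈ J j ∧ u ∉ J i := by
    intro i j
    by_contra! hu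
    obtain ⟨hi, hj, hij, -⟩ := hu ⊥
    refine h j hj i hi hij.symm ((hJ j).eq_of_le (hJ i) fun u huj => ?_)
    exact (hu u).2.2.2 huj
  choose u hu using hu
  -- `x i` avoids `J i` and lies in all the other `J j`, so `separated x (n + 1) i` avoids `J i`.
  let x : ℕ → L := fun i => (Finset.range (n + 1)).inf fun j => if j = i then ⊤ else u i j
  have hx_self : ∀ i < n + 1, x i ∉ J i := by
    intro i hi
    rw [(hJ i).isPrime.finsetInf_mem_iff]
    rintro ⟨j, hj, h'⟩
    split_ifs at h' with hij
    · exact (hJ i).isPrime.top_notMem' h'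
    · exact (hu i j hi (Finset.mem_range.1 hj) (Ne.symm hij)).2 h'
  have hx : ∀ i < n + 1, ∀ j < n + 1, i ≠ j → x i ∈ J j := by
    intro i hi j hj hij
    rw [(hJ j).isPrime.finsetInf_mem_iff]
    exact ⟨j, Finset.mem_range.2 hj, by simpa [hij.symm] using (hu i j hi hj hij).1⟩
  have hsep : ∀ i < n + 1, separated x (n + 1) i ∉ J i := by
    intro i hi
    rw [separated, (hJ i).isPrime.finsetInf_mem_iff]
    rintro ⟨j, hj, h'⟩
    rw [Finset.mem_range] at hj
    split_ifs at h' with hij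
    · subst hij; exact hx_self j hj h'
    · exact (hJ i).compl_notMem _ (hx j hj i hi hij) h'
  refine hP.top_notMem' ?_
  rw [← hL.sup_compl_separated hn x]
  exact Finset.sup_induction P.bot_mem (fun a ha b hb => P.sup_mem ha hb) fun i hi =>
    hJP i ((hJ i).compl_mem_iff.2 (hsep i (Finset.mem_range.1 hi)))

/-! ### Homomorphisms to `2ⁿ ⊕ 1` -/

theorem BPlus.compl_coe {n : ℕ} (s : Fin n → Bool) (hs : s ≠ ⊥) :
    (s : BPlus n)ᶜ = ((sᶜ : Fin n → Bool) : BPlus n) :=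
  if_neg hs

open Classical in
/-- The homomorphism to `2ⁿ ⊕ 1` given by a prime ideal `P` and a list `M` of all the minimal prime
ideals contained in `P`: elements outside `P` go to the new top, and an element `c ∈ P` goes to
`{i | c ∉ M i}`. -/
noncomputable def BPlus.homOfPrime {n : ℕ} {L : Type u} [PDLattice L] (P : Order.Ideal L)
    (hP : P.IsPrime) (M : Fin n → Order.Ideal L) (hM : ∀ i, IsMinimalPrimeIdeal (M i))
    (hMP : ∀ i, M i ≤ P)
    (hall : ∀ J : Order.Ideal L, IsMinimalPrimeIdeal J → J ≤ P → ∃ i, J = M i) :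
    PDHom L (BPlus n) where
  toFun c := if c ∈ P then ((fun i => decide (c ∉ M i) : Fin n → Bool) : BPlus n) else ⊤
  map_sup' x y := by
    have hs : x ⊔ y ∈ P ↔ x ∈ P ∧ y ∈ P := Ideal.sup_mem_iff
    by_cases hx : x ∈ P <;> by_cases hy : y ∈ P <;> simp only [hs, hx, hy, and_self, if_true,
      and_true, and_false, if_false, top_sup_eq, sup_top_eq]
    rw [← WithTop.coe_sup, WithTop.coe_inj]
    funext i
    simp [imp_iff_not_or]
  map_inf' x y := by
    have h (z : L) (hz : z ∉ P) (i : Fin n) : z ∉ M i := fun h => hz (hMP i h)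
    by_cases hx : x ∈ P <;> by_cases hy : y ∈ P <;> simp only [hP.inf_mem_iff, hx, hy, or_self,
      or_true, if_true, or_false, if_false, inf_top_eq, top_inf_eq] <;>
      simp only [← WithTop.coe_inf, WithTop.coe_inj]
    · funext i
      simp [(hM i).isPrime.inf_mem_iff]
    · funext i
      simp [(hM i).isPrime.inf_mem_iff, h y hy]
    · funext i
      simp [(hM i).isPrime.inf_mem_iff, h x hx]
  map_top' := if_neg hP.top_notMem'
  map_bot' := by
    rw [if_pos P.bot_mem, ← WithTop.coe_bot, WithTop.coe_inj]
    funext i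
    simp
  map_compl' c := by
    change (if cᶜ ∈ P then ((fun i => decide (cᶜ ∉ M i) : Fin n → Bool) : BPlus n) else ⊤) =
      (if c ∈ P then ((fun i => decide (c ∉ M i) : Fin n → Bool) : BPlus n) else ⊤)ᶜ
    by_cases hc' : cᶜ ∈ P
    · rw [if_pos hc']
      by_cases hc : c ∈ P
      · rw [if_pos hc, BPlus.compl_coe, WithTop.coe_inj]
        · funext i
          simp [(hM i).compl_mem_iff]
        -- As `M` lists all the minimal prime ideals in `P`, one of its members avoids `c`.
        · obtain ⟨J, hJ, hJP, hcJ⟩ := exists_isMinimalPrimeIdeal_le hP hc'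
          obtain ⟨i, rfl⟩ := hall J hJ hJP
          intro h
          simpa [hcJ] using congrFun h i
      · rw [if_neg hc, PDLattice.compl_top, ← WithTop.coe_bot, WithTop.coe_inj]
        funext i
        have : c ∉ M i := fun h => hc (hMP i h)
        simp [(hM i).compl_mem_iff, this]
    · have hc (i : Fin n) : c ∈ M i := by
        by_contra h
        exact hc' (hMP i ((hM i).compl_mem_iff.2 h))
      have hcP : c ∈ P := (hP.mem_or_mem
        (by rw [PDLattice.inf_compl_self]; exact P.bot_mem)).resolve_right hc'
      rw [if_neg hc', if_pos hcP, eq_comm, PDLattice.compl_eq_top,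
        ← WithTop.coe_bot, WithTop.coe_inj]
      funext i
      simp [hc i]

open Classical in
theorem BPlus.homOfPrime_apply {n : ℕ} {L : Type u} [PDLattice L] (P : Order.Ideal L)
    (hP : P.IsPrime) (M : Fin n → Order.Ideal L) (hM : ∀ i, IsMinimalPrimeIdeal (M i))
    (hMP : ∀ i, M i ≤ P)
    (hall : ∀ J : Order.Ideal L, IsMinimalPrimeIdeal J → J ≤ P → ∃ i, J = M i) (c : L) :
    homOfPrime P hP M hM hMP hall c =
      if c ∈ P then ((fun i => decide (c ∉ M i) : Fin n → Bool) : BPlus n) else ⊤ :=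
  rfl

/-! ### Products -/

instance Prod.instPDLattice (K : Type u) (L : Type v) [PDLattice K] [PDLattice L] :
    PDLattice (K × L) where
  toDistribLattice := inferInstance
  toBoundedOrder := inferInstance
  compl x := (x.1ᶜ, x.2ᶜ)
  le_compl_iff x y := by
    simp only [Prod.le_def, PDLattice.le_compl_iff, Prod.ext_iff]
    rfl

theorem PDTerm.eval_prod {K : Type u} {L : Type v} [PDLattice K] [PDLattice L] (ρ : ℕ → K × L)
    (t : PDTerm) :
    t.eval ρ = (t.eval fun i => (ρ i).1, t.eval fun i => (ρ i).2) := by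
  induction t with
  | var i => rfl
  | bot => rfl
  | top => rfl
  | sup s t hs ht => simp only [eval, hs, ht]; rfl
  | inf s t hs ht => simp only [eval, hs, ht]; rfl
  | compl s hs => simp only [eval, hs]; rfl

theorem VarietyB.prod {n : ℕ} {K : Type u} {L : Type v} [PDLattice K] [PDLattice L]
    (hK : VarietyB n K) (hL : VarietyB n L) : VarietyB n (K × L) := by
  intro s t h ρ
  rw [PDTerm.eval_prod, PDTerm.eval_prod, hK s t h, hL s t h]

namespace PDHom

variable {A : Type*} {B : Type*} {C : Type*} [PDLattice A] [PDLattice B] [PDLattice C]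

theorem map_sup (f : PDHom A B) (x y : A) : f (x ⊔ y) = f x ⊔ f y := f.map_sup' x y

theorem map_inf (f : PDHom A B) (x y : A) : f (x ⊓ y) = f x ⊓ f y := f.map_inf' x y

theorem map_bot (f : PDHom A B) : f ⊥ = ⊥ := f.map_bot'

theorem map_top (f : PDHom A B) : f ⊤ = ⊤ := f.map_top'

theorem map_compl (f : PDHom A B) (x : A) : f xᶜ = (f x)ᶜ := f.map_compl' x

theorem mono (f : PDHom A B) {x y : A} (h : x ≤ y) : f x ≤ f y := by
  rw [← inf_eq_left, ← map_inf, inf_eq_left.2 h]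

theorem le_of_map_le (f : PDHom A B) (hf : Function.Injective f) {x y : A} (h : f x ≤ f y) :
    x ≤ y := by
  rw [← inf_eq_left] at h ⊢
  exact hf ((f.map_inf x y).trans h)

/-- The graph `a ↦ (a, f a)` of a homomorphism, as a homomorphism to the product. -/
def graph (f : PDHom A B) : PDHom A (A × B) where
  toFun a := (a, f a)
  map_sup' x y := Prod.ext rfl (f.map_sup x y)
  map_inf' x y := Prod.ext rfl (f.map_inf x y)
  map_top' := Prod.ext rfl f.map_top
  map_bot' := Prod.ext rfl f.map_bot
  map_compl' x := Prod.ext rfl (f.map_compl x)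

/-- Composition of homomorphisms. -/
def comp (g : PDHom B C) (f : PDHom A B) : PDHom A C where
  toFun a := g (f a)
  map_sup' x y := by rw [f.map_sup, g.map_sup]
  map_inf' x y := by rw [f.map_inf, g.map_inf]
  map_top' := by rw [f.map_top, g.map_top]
  map_bot' := by rw [f.map_bot, g.map_bot]
  map_compl' x := (congrArg g (f.map_compl x)).trans (g.map_compl (f x))

end PDHom

/-! ### Extending the projection of a product with `2ⁿ ⊕ 1` -/

/-- If `A × (2ⁿ ⊕ 1)` is embedded in a lattice `C`, some prime ideal of `C` meets it exactly in
`A × 2ⁿ`. -/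
theorem exists_isPrime_mem_iff {n : ℕ} {A C : Type*} [PDLattice A] [PDLattice C]
    (β : PDHom (A × BPlus n) C) (hβ : Function.Injective β) :
    ∃ P : Order.Ideal C, P.IsPrime ∧ ∀ x : A × BPlus n, β x ∈ P ↔ x.2 ≠ ⊤ := by
  have hI : IsIdeal {c : C | ∃ s : Fin n → Bool, c ≤ β (⊤, (s : BPlus n))} := by
    refine ⟨fun c d hdc ⟨s, hs⟩ => ⟨s, le_trans hdc hs⟩, ⟨⊥, ⊥, bot_le⟩, ?_⟩
    rintro c ⟨s, hs⟩ d ⟨t, ht⟩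
    refine ⟨c ⊔ d, ⟨s ⊔ t, ?_⟩, le_sup_left, le_sup_right⟩
    refine sup_le (hs.trans (β.mono ?_)) (ht.trans (β.mono ?_))
    · exact ⟨le_rfl, WithTop.coe_le_coe.2 le_sup_left⟩
    · exact ⟨le_rfl, WithTop.coe_le_coe.2 le_sup_right⟩
  obtain ⟨P, hP, hIP, hFP⟩ := DistribLattice.prime_ideal_of_disjoint_filter_ideal
    (F := PFilter.principal (β (⊥, ⊤))) (I := hI.toIdeal) (by
      rw [Set.disjoint_left]
      rintro c hc ⟨s, hs⟩
      have h := β.le_of_map_le hβ (le_trans (PFilter.mem_principal.1 hc) hs)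
      exact WithTop.coe_ne_top (top_le_iff.1 h.2))
  refine ⟨P, hP, ?_⟩
  rintro ⟨a, b⟩
  induction b using WithTop.recTopCoe with
  | top =>
    refine iff_of_false (fun h => ?_) (by simp)
    exact Set.disjoint_left.1 hFP (show β (a, ⊤) ∈ _ from
      PFilter.mem_principal.2 (β.mono ⟨bot_le, le_rfl⟩)) h
  | coe s => exact iff_of_true (hIP ⟨s, β.mono ⟨le_top, le_rfl⟩⟩) (by simp)

/-- If `A × (2ⁿ ⊕ 1)` is embedded in a member `C` of `𝓑ₙ`, its second projection extends to `C`. -/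
theorem exists_extend_snd {n : ℕ} (hn : 1 ≤ n) {A C : Type*} [PDLattice A] [PDLattice C]
    (hC : VarietyB n C) (β : PDHom (A × BPlus n) C) (hβ : Function.Injective β) :
    ∃ h : PDHom C (BPlus n), ∀ x, h (β x) = x.2 := by
  obtain ⟨P, hP, hβP⟩ := exists_isPrime_mem_iff β hβ
  have hM (i : Fin n) :
      ∃ J : Order.Ideal C, IsMinimalPrimeIdeal J ∧ J ≤ P ∧ β (⊥, BPlus.atom i) ∉ J := by
    refine exists_isMinimalPrimeIdeal_le hP ?_
    rw [← β.map_compl, hβP]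
    exact fun h => BPlus.atom_ne_bot i (PDLattice.compl_eq_top.1 h)
  choose M hM hMP hatom using hM
  have hmem (i : Fin n) (a : A) (s : Fin n → Bool) : β (a, (s : BPlus n)) ∉ M i ↔ s i = true := by
    by_cases hi : s i = true
    · refine iff_of_true (fun h => hatom i ((M i).lower (β.mono ?_) h)) hi
      exact ⟨bot_le, BPlus.atom_le_coe.2 hi⟩
    · refine iff_of_false (not_not.2 ?_) hi
      refine ((hM i).isPrime.mem_or_mem (x := β (⊥, BPlus.atom i)) ?_).resolve_left (hatom i)
      have h : ((⊥, BPlus.atom i) : A × BPlus n) ⊓ (a, (s : BPlus n)) = ⊥ := by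
        refine Prod.ext (bot_inf_eq a) ?_
        change ((_ : Fin n → Bool) : BPlus n) ⊓ (s : BPlus n) = ((⊥ : Fin n → Bool) : BPlus n)
        rw [← WithTop.coe_inf, WithTop.coe_inj]
        funext j
        by_cases hj : j = i
        · subst hj; simpa using hi
        · simp [hj]
      rw [← β.map_inf, h, β.map_bot]
      exact (M i).bot_mem
  have hinj : Function.Injective M := by
    intro i j hij
    have h := hmem i ⊥ (fun k => decide (k = i))
    rw [hij, hmem] at h
    simpa [eq_comm] using h
  -- The `n` ideals `M i` exhaust the at most `n` minimal prime ideals contained in `P`.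
  have hall (J : Order.Ideal C) (hJ : IsMinimalPrimeIdeal J) (hJP : J ≤ P) : ∃ i, J = M i := by
    by_contra! hne
    let N : ℕ → Order.Ideal C := fun k => if hk : k < n then M ⟨k, hk⟩ else J
    obtain ⟨i, hi, j, hj, hij, h⟩ := hC.exists_eq_of_isMinimalPrimeIdeal hn hP N
      (fun k => by by_cases hk : k < n <;> simp [N, hk, hM, hJ])
      (fun k => by by_cases hk : k < n <;> simp [N, hk, hMP, hJP])
    by_cases hi' : i < n <;> by_cases hj' : j < n <;> simp only [N, hi', hj', dite_true,
      dite_false] at h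
    · exact hij (Fin.mk.inj (hinj h))
    · exact hne _ h.symm
    · exact hne _ h
    · omega
  refine ⟨BPlus.homOfPrime P hP M hM hMP hall, ?_⟩
  rintro ⟨a, b⟩
  rw [BPlus.homOfPrime_apply]
  induction b using WithTop.recTopCoe with
  | top => exact if_neg (by simp [hβP])
  | coe s =>
    rw [if_pos ((hβP _).2 (by simp)), WithTop.coe_inj]
    funext i
    simp [hmem]

theorem mainTheorem3 (n : ℕ) (hn : 2 ≤ n) (A : Type u) [PDLattice A]
    (hA : IsAmalgamationBase.{u} (fun L _ => VarietyB n L) A)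
    (B : Type u) [PDLattice B] (hB : VarietyB n B)
    (ι : PDHom A B) (hι : Function.Injective ι) (f : PDHom A (BPlus n)) :
    ∃ g : PDHom B (BPlus n), ∀ a : A, g (ι a) = f a := by
  obtain ⟨C, _, hC, β₀, β₁, -, hβ₁, hcomm⟩ := hA.2 B (A × BPlus n) hB
    (hA.1.prod fun _ _ h => h) ι f.graph hι fun _ _ h => congrArg Prod.fst h
  obtain ⟨h, hh⟩ := exists_extend_snd (by omega) hC β₁ hβ₁
  exact ⟨h.comp β₀, fun a => (congrArg h (hcomm a)).trans (hh (f.graph a))⟩
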